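/- A metric space $(X,d)$ is called a Banakh space if for every point $c\in X$ and every $s\in d[X^2]:=\{d(x,y):x,y\in X\}$ there are points $x,y\in X$ such that $\{z\in X:d(z,c)=s\}=\{x,y\}$ and $d(x,y)=2s$. Let $a,b$ be points of a Banakh space $X$, let $r:=d(a,b)$, $\mathbb Qr:=\{qr:q\in\mathbb Q\}$ and $M_r:=d[X^2]\cap\mathbb Qr$, and put $M_r-M_r:=\{u-v:u,v\in M_r\}$ and $\pm M_r:=M_r\cup(-M_r)$. For $x\in X$ let $S(x;\mathbb Qr):=\{y\in X:d(x,y)\in\mathbb Qr\}$, and let $S^{\pm}(a;\mathbb Qr):=\bigcup_{y\in S(a;\mathbb Qr)}S(y;\mathbb Qr)$ be the $\mathbb Qr$-hypersphere around $a$. Then $M_r-M_r$ is a subgroup of $\mathbb Qr$, and there exists a unique bijective function $\ell:M_r-M_r\to S^{\pm}(a;\mathbb Qr)$ such that $\ell(0)=a$, $\ell(r)=b$, $\ell[\pm M_r]=S(a;\mathbb Qr)$, and for all $s,t\in M_r-M_r$ the following two conditions hold: (1) $|s-t|\le d(\ell(s),\ell(t))\le\inf\{u+v:u,v\in M_r,\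 |t-s|=u-v\}$; (2) $d(\ell(s),\ell(t))=|s-t|$ if and only if $|s-t|\in M_r$, if and only if $d(\ell(s),\ell(t))\in\mathbb Qr$. -/

import Mathlib

open scoped Pointwise

namespace Banakh

/-- The set of distances `d[X²] = {d(x,y) : x, y ∈ X}`. -/
def distSet (X : Type*) [MetricSpace X] : Set ℝ :=
  {s | ∃ x y : X, dist x y = s}

/-- A metric space is a Banakh space if for all `c ∈ X` and `s ∈ d[X²]` the sphere
`S(c;s) = {x : d(x,c) = s}` is of the form `{x, y}` with `d(x,y) = 2s`. -/
def IsBanakh (X : Type*) [MetricSpace X] : Prop :=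
  ∀ c : X, ∀ s ∈ distSet X, ∃ x y : X, Metric.sphere c s = {x, y} ∧ dist x y = 2 * s

/-- The set `ℚr = {q * r : q ∈ ℚ}` of rational multiples of a real number `r`. -/
def ratMultiples (r : ℝ) : Set ℝ :=
  {s | ∃ q : ℚ, s = (q : ℝ) * r}

/-- The `D`-sphere `S(x;D) = {y : d(x,y) ∈ D}` around `x`. -/
def dSphere {X : Type*} [MetricSpace X] (x : X) (D : Set ℝ) : Set X :=
  {y | dist x y ∈ D}

/-- The `ℚr`-hypersphere `S^±(x;ℚr)`, the union of `S(y;ℚr)` over all `y ∈ S(x;ℚr)`. -/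
def hypersphere {X : Type*} [MetricSpace X] (x : X) (r : ℝ) : Set X :=
  ⋃ y ∈ dSphere x (ratMultiples r), dSphere y (ratMultiples r)

/-- The set `M_r = d[X²] ∩ ℚr`. -/
def ratDist (X : Type*) [MetricSpace X] (r : ℝ) : Set ℝ :=
  distSet X ∩ ratMultiples r

/-- The set of differences `M_r - M_r = {u - v : u, v ∈ M_r}`. -/
def ratDiff (X : Type*) [MetricSpace X] (r : ℝ) : Set ℝ :=
  ratDist X r - ratDist X r

theorem zero_mem_ratDist {X : Type*} [MetricSpace X] (a : X) (r : ℝ) :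
    (0 : ℝ) ∈ ratDist X r :=
  ⟨⟨a, a, dist_self a⟩, ⟨0, by simp⟩⟩

theorem zero_mem_ratDiff {X : Type*} [MetricSpace X] (a : X) (r : ℝ) :
    (0 : ℝ) ∈ ratDiff X r :=
  ⟨0, zero_mem_ratDist a r, 0, zero_mem_ratDist a r, sub_zero 0⟩

theorem mem_ratDiff_of_eq_dist {X : Type*} [MetricSpace X] {a b : X} {r : ℝ}
    (hr : r = dist a b) : r ∈ ratDiff X r :=
  ⟨r, ⟨⟨a, b, hr.symm⟩, ⟨1, by simp⟩⟩, 0, zero_mem_ratDist a r, sub_zero r⟩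

end Banakh

/-! A sphere of radius `s` is a pair at distance `2s`, so two points equidistant from a third
coincide or are antipodal about it. Iterating antipodes puts any two points on an isometric copy of
a multiple of `ℤ` (`exists_line`). Two segments of positive commensurable lengths issuing from one
point prolong to a common length, and since the sphere of that radius has only two points, both
lines pass through them. Hence a segment extends by any commensurable distance
(`exists_extension_of_mul_eq`), which makes `M_r` closed under addition, and triangles with
commensurable sides are degenerate (`degenerate_of_mul_eq`).

The sphere `S(a;ℚr)` therefore splits into two opposite rays `f` and `g`. Since `f u` and `g v` are
`u + v` apart, exactly one point lies at distance `v` from `f u` and `u` from `g v`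
(`exists_between`, `between_unique`). It depends only on `u - v` and is taken as `ℓ (u - v)`. Its
metric properties are read off from distances to ray points. Conversely, condition (2) and the
values at `0` and `r` fix a competing map on both rays, hence everywhere. -/

namespace Banakh

variable {X : Type*} [MetricSpace X]

/-! ### Two-point spheres and antipodes -/

section Spheres

theorem dist_mem_distSet (x y : X) : dist x y ∈ distSet X := ⟨x, y, rfl⟩

theorem nonneg_of_mem_distSet {s : ℝ} (hs : s ∈ distSet X) : 0 ≤ s := by
  obtain ⟨x, y, rfl⟩ := hs
  exact dist_nonneg

theorem IsBanakh.exists_antipodal (hX : IsBanakh X) (c : X) {s : ℝ} (hs : s ∈ distSet X) :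
    ∃ x y : X, dist c x = s ∧ dist c y = s ∧ dist x y = 2 * s ∧
      ∀ z, dist c z = s → z = x ∨ z = y := by
  obtain ⟨x, y, h, hxy⟩ := hX c s hs
  have key : ∀ z, dist c z = s ↔ z = x ∨ z = y := fun z => by
    rw [dist_comm, ← Metric.mem_sphere, h, Set.mem_insert_iff, Set.mem_singleton_iff]
  exact ⟨x, y, (key x).2 (Or.inl rfl), (key y).2 (Or.inr rfl), hxy, fun z => (key z).1⟩

theorem IsBanakh.eq_or_dist_eq (hX : IsBanakh X) {c x y : X} {s : ℝ} (hx : dist c x = s)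
    (hy : dist c y = s) : x = y ∨ dist x y = 2 * s := by
  obtain ⟨p, q, -, -, hpq, h⟩ := hX.exists_antipodal c ⟨c, x, hx⟩
  rcases h x hx with rfl | rfl <;> rcases h y hy with rfl | rfl
  · exact Or.inl rfl
  · exact Or.inr hpq
  · exact Or.inr (by rw [dist_comm, hpq])
  · exact Or.inl rfl

theorem IsBanakh.exists_reflection (hX : IsBanakh X) (c x : X) :
    ∃ y, dist c y = dist c x ∧ dist x y = 2 * dist c x := by
  obtain ⟨p, q, hp, hq, hpq, h⟩ := hX.exists_antipodal c (dist_mem_distSet c x)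
  rcases h x rfl with rfl | rfl
  · exact ⟨q, hq, hpq⟩
  · exact ⟨p, hp, by rw [dist_comm, hpq]⟩

/-- The point of the sphere around `c` through `x` that is antipodal to `x`. -/
noncomputable def IsBanakh.reflection (hX : IsBanakh X) (c x : X) : X :=
  (hX.exists_reflection c x).choose

theorem IsBanakh.dist_center_reflection (hX : IsBanakh X) (c x : X) :
    dist c (hX.reflection c x) = dist c x :=
  (hX.exists_reflection c x).choose_spec.1

theorem IsBanakh.dist_reflection (hX : IsBanakh X) (c x : X) :
    dist x (hX.reflection c x) = 2 * dist c x :=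
  (hX.exists_reflection c x).choose_spec.2

/-- Two distinct antipodes of `x` would themselves be antipodal, giving an equilateral triangle of
side `2s`. Two of its vertices lie on a sphere of radius `2s` about the third, so they should be
`4s` apart, which forces `s = 0`. -/
theorem IsBanakh.eq_reflection (hX : IsBanakh X) {c x y : X} (hy : dist c y = dist c x)
    (hxy : dist x y = 2 * dist c x) : y = hX.reflection c x := by
  rcases hX.eq_or_dist_eq hy (hX.dist_center_reflection c x) with h | h
  · exact h
  · rcases hX.eq_or_dist_eq (c := y) (x := x) (y := hX.reflection c x) (s := 2 * dist c x)
      (by rw [dist_comm, hxy]) h with h' | h'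
    · have := hX.dist_reflection c x
      rw [← h', dist_self] at this
      rw [← dist_eq_zero, h]
      linarith
    · have := hX.dist_reflection c x
      rw [← dist_eq_zero, h]
      linarith

theorem IsBanakh.reflection_reflection (hX : IsBanakh X) (c x : X) :
    hX.reflection c (hX.reflection c x) = x := by
  refine (hX.eq_reflection (hX.dist_center_reflection c x).symm ?_).symm
  rw [dist_comm, hX.dist_reflection, hX.dist_center_reflection]

end Spheres

/-! ### Isometric copies of scaled integers -/

section Lines

/-- The shift `(x, y) ↦ (y, z)` of a pair of points, where `z` is antipodal to `x` about `y`. -/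
noncomputable def IsBanakh.shift (hX : IsBanakh X) : Equiv.Perm (X × X) where
  toFun p := (p.2, hX.reflection p.2 p.1)
  invFun p := (hX.reflection p.1 p.2, p.1)
  left_inv p := by simp [hX.reflection_reflection]
  right_inv p := by simp [hX.reflection_reflection]

theorem dist_eq_mul_of_steps (hX : IsBanakh X) {s : ℝ} (hs : 0 < s) {x : ℤ → X}
    (h1 : ∀ i, dist (x i) (x (i + 1)) = s) (h2 : ∀ i, dist (x i) (x (i + 2)) = 2 * s) (n : ℕ) :
    ∀ i, dist (x i) (x (i + n)) = n * s := by
  induction n using Nat.strong_induction_on with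
  | _ n ih =>
  have ih' : ∀ k : ℕ, k < n → ∀ i j : ℤ, j = i + k → dist (x i) (x j) = k * s := by
    rintro k hk i j rfl
    exact ih k hk i
  intro i
  obtain rfl | rfl | rfl | hn : n = 0 ∨ n = 1 ∨ n = 2 ∨ 3 ≤ n := by omega
  · simp
  · simpa using h1 i
  · simpa using h2 i
  obtain ⟨m, rfl | rfl⟩ := Nat.even_or_odd' n
  -- Even length: the endpoints are equidistant from the midpoint. If they coincided, the distance
  -- `(2m - 1)s` known by induction would equal one step `s`.
  · have hm : (2 : ℝ) ≤ m := by exact_mod_cast (show 2 ≤ m by omega)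
    have e1 := ih' m (by omega) i (i + m) rfl
    have e2 := ih' m (by omega) (i + m) (i + (2 * m : ℕ)) (by push_cast; ring)
    rw [dist_comm] at e1
    rcases hX.eq_or_dist_eq e1 e2 with h | h
    · have e3 := ih' (2 * m - 1) (by omega) i (i + (2 * m : ℕ) - 1)
        (by push_cast [Nat.cast_sub (show 1 ≤ 2 * m by omega)]; ring)
      have e4 := h1 (i + (2 * m : ℕ) - 1)
      rw [sub_add_cancel, ← h, dist_comm, e3] at e4
      push_cast [Nat.cast_sub (show 1 ≤ 2 * m by omega)] at e4
      nlinarith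
    · rw [h]; push_cast; ring
  · have hm : (1 : ℝ) ≤ m := by exact_mod_cast (show 1 ≤ m by omega)
    obtain ⟨c, rfl⟩ : ∃ c : ℤ, i = c - (2 * m : ℕ) := ⟨i + (2 * m : ℕ), by ring⟩
    have e1 := ih' (2 * m) (by omega) (c - (2 * m : ℕ)) c (by ring)
    have e2 := ih' (2 * m) (by omega) c (c + (2 * m : ℕ)) rfl
    have e3 := ih' (2 * m - 1) (by omega) (c + 1) (c + (2 * m : ℕ))
        (by push_cast [Nat.cast_sub (show 1 ≤ 2 * m by omega)]; ring)
    have e4 := ih' (2 * m - 1) (by omega) (c - (2 * m : ℕ)) (c - 1)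
        (by push_cast [Nat.cast_sub (show 1 ≤ 2 * m by omega)]; ring)
    push_cast [Nat.cast_sub (show 1 ≤ 2 * m by omega)] at e1 e2 e3 e4
    -- Odd length: the antipode `y` of `x (c + 2m)` about `x c` has the desired distance to `x (c +
    -- 1)`, so `x (c - 2m) = y` suffices. Otherwise `x (c - 2m) = x (c + 2m)`, and then `x (c - 1)`
    -- and `x (c + 1)` lie on one sphere of radius `(2m + 1)s` about `y` while being only `2s`
    -- apart.
    obtain ⟨y, hy1, hy2⟩ := hX.exists_reflection (x c) (x (c + (2 * m : ℕ)))
    push_cast at hy1 hy2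
    rw [e2] at hy1 hy2
    have e5 : dist y (x (c + 1)) = (2 * m + 1) * s := by
      have t1 := dist_triangle_left y (x (c + 1)) (x c)
      have t2 := dist_triangle_left (x (c + 2 * m)) y (x (c + 1))
      have := h1 c
      rw [dist_comm (x (c + 1)) y] at t2
      linarith
    have e6 : c - (2 * m : ℕ) + (2 * m + 1 : ℕ) = c + 1 := by push_cast; ring
    rw [e6]
    push_cast
    rw [dist_comm] at e1
    rcases hX.eq_or_dist_eq hy1 e1 with h | h
    · rw [← h, e5]
    · have e7 : x (c - 2 * m) = x (c + 2 * m) := by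
        rcases hX.eq_or_dist_eq e1 e2 with h' | h'
        · exact h'
        · have k1 : x (c - 2 * m) = hX.reflection (x c) (x (c + 2 * m)) :=
            hX.eq_reflection (by rw [e1, e2]) (by rw [dist_comm, h', e2])
          have k2 : y = hX.reflection (x c) (x (c + 2 * m)) :=
            hX.eq_reflection (by rw [hy1, e2]) (by rw [hy2, e2])
          rw [k1, k2, dist_self] at h
          nlinarith
      have e8 : dist y (x (c - 1)) = (2 * m + 1) * s := by
        have t1 := dist_triangle_left y (x (c - 1)) (x c)
        have t2 := dist_triangle_left (x (c + 2 * m)) y (x (c - 1))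
        have := h1 (c - 1)
        rw [sub_add_cancel, dist_comm] at this
        rw [dist_comm (x (c - 1)) y] at t2
        rw [e7, dist_comm] at e4
        linarith
      have e9 := h2 (c - 1)
      rw [show c - 1 + 2 = c + 1 by ring] at e9
      rcases hX.eq_or_dist_eq e8 e5 with h' | h'
      · rw [h', dist_self] at e9
        linarith
      · nlinarith

/-- Any two points lie at consecutive positions on an isometric copy of `ℤ`, scaled by their
distance. -/
theorem IsBanakh.exists_line (hX : IsBanakh X) {a b : X} {s : ℝ} (hs : dist a b = s) :
    ∃ x : ℤ → X, x 0 = a ∧ x 1 = b ∧ ∀ i j : ℤ, dist (x i) (x j) = |(i : ℝ) - j| * s := by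
  rcases (hs ▸ dist_nonneg : 0 ≤ s).eq_or_lt with rfl | hpos
  · exact ⟨fun _ => a, rfl, dist_eq_zero.1 hs, fun i j => by simp⟩
  set p : ℤ → X × X := fun n => (hX.shift ^ n) (a, b) with hp
  have hsucc : ∀ n, p (n + 1) = hX.shift (p n) := fun n => by
    simp only [hp, add_comm n 1, zpow_add, zpow_one, Equiv.Perm.mul_apply]
  have hp2 : ∀ n, (p n).2 = (p (n + 1)).1 := fun n => by rw [hsucc]; rfl
  have hp3 : ∀ n, (p (n + 2)).1 = hX.reflection (p (n + 1)).1 (p n).1 := fun n => by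
    rw [show n + 2 = n + 1 + 1 by ring, ← hp2 (n + 1), ← hp2 n, hsucc n]; rfl
  have hstep : ∀ n, dist (p n).1 (p (n + 1)).1 = dist (p (n + 1)).1 (p (n + 1 + 1)).1 := fun n => by
    rw [show n + 1 + 1 = n + 2 by ring, hp3, hX.dist_center_reflection, dist_comm]
  have h0 : p 0 = (a, b) := by simp [hp]
  have h1 : ∀ n, dist (p n).1 (p (n + 1)).1 = s := fun n => by
    induction n using Int.induction_on with
    | zero => rw [← hp2, h0, hs]
    | succ n ih => rw [← hstep, ih]
    | pred n ih =>
      rw [hstep, sub_add_cancel, ih]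
  have h2 : ∀ n, dist (p n).1 (p (n + 2)).1 = 2 * s := fun n => by
    rw [hp3, hX.dist_reflection, dist_comm, h1]
  have key := dist_eq_mul_of_steps hX hpos (x := fun n => (p n).1) h1 h2
  refine ⟨fun n => (p n).1, by simp [h0], ?_, ?_⟩
  · have := hp2 0
    simp only [zero_add] at this
    simp [← this, h0]
  · have hle : ∀ i j : ℤ, i ≤ j → dist (p i).1 (p j).1 = |(i : ℝ) - j| * s := fun i j hij => by
      obtain ⟨k, rfl⟩ := Int.le.dest hij
      rw [key]
      simp
    intro i j
    rcases le_total i j with h | h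
    · exact hle i j h
    · rw [dist_comm, abs_sub_comm]
      exact hle j i h

/-- The far points at distance `k * s` on the line through `a` and `b`. -/
theorem IsBanakh.exists_far (hX : IsBanakh X) {a b : X} {s : ℝ} (hs : dist a b = s) {k : ℕ}
    (hk : 0 < k) : ∃ z w z' : X, dist a z = k * s ∧ dist b z = k * s - s ∧ dist b w = k * s ∧
      dist a w = k * s + s ∧ dist z w = s ∧ dist a z' = k * s ∧ dist b z' = k * s + s ∧
      dist z z' = 2 * (k * s) := by
  obtain ⟨x, rfl, rfl, hx⟩ := hX.exists_line hs
  have hk' : (1 : ℝ) ≤ k := by exact_mod_cast hk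
  refine ⟨x k, x (k + 1), x (-k), ?_, ?_, ?_, ?_, ?_, ?_, ?_, ?_⟩ <;> rw [hx] <;> push_cast
  · rw [abs_of_nonpos (by linarith)]; ring
  · rw [abs_of_nonpos (by linarith)]; ring
  · rw [abs_of_nonpos (by linarith)]; ring
  · rw [abs_of_nonpos (by linarith)]; ring
  · rw [abs_of_nonpos (by linarith)]; ring
  · rw [abs_of_nonneg (by linarith)]; ring
  · rw [abs_of_nonneg (by linarith)]; ring
  · rw [abs_of_nonneg (by linarith)]; ring

end Lines

/-! ### Extension of segments and degeneracy of triangles -/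

section Commensurable

/-- Let `z'` lie beyond `p` on the line from `a`, at distance `k * u = l * w` from `p`. The line
through `p` and either point of the sphere of radius `w` also meets `z'`. A point on the same side
as `z'` is the extension, by the triangle inequality from `a` to `z'`. -/
theorem IsBanakh.exists_extension_of_mul_eq (hX : IsBanakh X) {a p : X} {u w : ℝ}
    (hu : dist a p = u) (hw : w ∈ distSet X) {k l : ℕ} (hk : 0 < k) (hl : 0 < l)
    (hkl : k * u = l * w) : ∃ q, dist p q = w ∧ dist a q = u + w := by
  obtain ⟨z, -, z', hz, -, -, -, -, hz', haz', hzz'⟩ :=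
    hX.exists_far (by rw [dist_comm, hu] : dist p a = u) hk
  obtain ⟨q, -, hq, -, -, -⟩ := hX.exists_antipodal p hw
  obtain ⟨y, -, y', hy, hqy, -, -, -, hy', hqy', hyy'⟩ := hX.exists_far hq hl
  rw [← hkl] at hy hqy hy' hqy' hyy'
  obtain ⟨q', hq', hqq'⟩ := hX.exists_reflection p q
  have aux : ∀ q, dist p q = w → dist q z' = k * u - w → dist p q = w ∧ dist a q = u + w := by
    intro q hq h
    refine ⟨hq, le_antisymm ?_ ?_⟩
    · linarith [dist_triangle a p q]
    · linarith [dist_triangle a q z']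
  rcases hX.eq_or_dist_eq hy hz' with h | h
  · exact ⟨q, aux q hq (h ▸ hqy)⟩
  · have e : z' = y' := (hX.eq_reflection (hz'.trans hy.symm) (by rw [h, hy])).trans
      (hX.eq_reflection (hy'.trans hy.symm) (by rw [hyy', hy])).symm
    obtain ⟨v, -, v', hv, hqv, -, -, -, hv', hqv', hvv'⟩ := hX.exists_far (hq'.trans hq) hl
    rw [← hkl] at hv hqv hv' hqv' hvv'
    rcases hX.eq_or_dist_eq hv hz' with h1 | h1
    · exact ⟨q', aux q' (hq'.trans hq) (h1 ▸ hqv)⟩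
    · have e' : z' = v' := (hX.eq_reflection (hz'.trans hv.symm) (by rw [h1, hv])).trans
        (hX.eq_reflection (hv'.trans hv.symm) (by rw [hvv', hv])).symm
      rw [← e] at hqy'
      rw [← e'] at hqv'
      have hw0 := nonneg_of_mem_distSet hw
      have hwl : w ≤ l * w := le_mul_of_one_le_left hw0 (by exact_mod_cast hl)
      -- Both `q` and its antipode now lie opposite to `z'`, at distance `k * u + w` from it. Being
      -- `2w` apart, they force `w = 0`.
      rcases hX.eq_or_dist_eq (c := z') (by rw [dist_comm, hqy']) (by rw [dist_comm, hqv'])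
        with h2 | h2
      · rw [← h2, dist_self, hq] at hqq'
        exact ⟨q, aux q hq (by linarith)⟩
      · rw [hqq', hq] at h2
        exact ⟨q, aux q hq (by linarith)⟩

/-- Prolong all sides to the common length `N = k * t`. If the lines from `a` reach `N` at opposite
points, then `w = s + t`. If at the same point, then `W`, at distance `N` from `q` away from `a`,
satisfies `dist p W = N + (t - s)`, while the line through `q` and `p` allows only `N - w` or `N +
w`. -/
theorem IsBanakh.degenerate_of_mul_eq (hX : IsBanakh X) {a p q : X} {s t w : ℝ}
    (hs : dist a p = s) (ht : dist a q = t) (hw : dist p q = w) {k l m : ℕ} (hk : 0 < k)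
    (hl : 0 < l) (hm : 0 < m) (hkl : k * t = l * s) (hkm : k * t = m * w) :
    w = s + t ∨ w = |s - t| := by
  obtain ⟨z, W, z', hz, hqz, hqW, haW, hzW, hz', hqz', hzz'⟩ := hX.exists_far ht hk
  obtain ⟨y, -, y', hy, hpy, -, -, -, hy', hpy', hyy'⟩ := hX.exists_far hs hl
  rw [← hkl] at hy hpy hy' hpy' hyy'
  have hpq : w ≤ s + t := by
    have := dist_triangle_left p q a
    linarith
  have hlow : |s - t| ≤ w := by
    have := abs_dist_sub_le p q a
    rw [dist_comm p a, dist_comm q a] at this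
    rwa [hs, ht, hw] at this
  rcases hX.eq_or_dist_eq hz hy with h | h
  · right
    rw [← h] at hpy
    have h1 := dist_triangle p z W
    have h2 := dist_triangle a p W
    obtain ⟨v, -, v', hv, hpv, -, -, -, hv', hpv', hvv'⟩ :=
      hX.exists_far (by rw [dist_comm, hw] : dist q p = w) hm
    rw [← hkm] at hv hpv hv' hpv' hvv'
    have hpW : dist p W = k * t + (t - s) := by linarith
    rcases hX.eq_or_dist_eq hv hqW with h3 | h3
    · rw [← h3] at hpW
      rw [show w = s - t by linarith] at hlow ⊢
      exact le_antisymm (le_abs_self _) hlow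
    · have e : W = v' := (hX.eq_reflection (hqW.trans hv.symm) (by rw [h3, hv])).trans
        (hX.eq_reflection (hv'.trans hv.symm) (by rw [hvv', hv])).symm
      rw [← e] at hpv'
      rw [show w = t - s by linarith, abs_sub_comm] at hlow ⊢
      exact le_antisymm (le_abs_self _) hlow
  · left
    have e : y = z' := (hX.eq_reflection (hy.trans hz.symm) (by rw [h, hz])).trans
      (hX.eq_reflection (hz'.trans hz.symm) (by rw [hzz', hz])).symm
    rw [e] at hpy
    have := dist_triangle_left q z' p
    linarith

end Commensurable

/-! ### Arithmetic of `M_r` and points between -/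

section RatDist

variable {r : ℝ}

theorem add_mem_ratMultiples {u v : ℝ} (hu : u ∈ ratMultiples r) (hv : v ∈ ratMultiples r) :
    u + v ∈ ratMultiples r := by
  obtain ⟨p, rfl⟩ := hu
  obtain ⟨q, rfl⟩ := hv
  exact ⟨p + q, by push_cast; ring⟩

theorem neg_mem_ratMultiples {u : ℝ} (hu : u ∈ ratMultiples r) : -u ∈ ratMultiples r := by
  obtain ⟨p, rfl⟩ := hu
  exact ⟨-p, by push_cast; ring⟩

theorem sub_mem_ratMultiples {u v : ℝ} (hu : u ∈ ratMultiples r) (hv : v ∈ ratMultiples r) :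
    u - v ∈ ratMultiples r :=
  sub_eq_add_neg u v ▸ add_mem_ratMultiples hu (neg_mem_ratMultiples hv)

theorem abs_mem_ratMultiples {u : ℝ} (hu : u ∈ ratMultiples r) : |u| ∈ ratMultiples r := by
  rcases abs_choice u with h | h <;> rw [h]
  exacts [hu, neg_mem_ratMultiples hu]

theorem nonneg_of_mem_ratDist {u : ℝ} (hu : u ∈ ratDist X r) : 0 ≤ u :=
  nonneg_of_mem_distSet hu.1

theorem exists_mul_eq_mul {u v : ℝ} (hu : u ∈ ratMultiples r) (hv : v ∈ ratMultiples r)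
    (hu0 : 0 < u) (hv0 : 0 < v) : ∃ k l : ℕ, 0 < k ∧ 0 < l ∧ k * u = l * v := by
  obtain ⟨p, rfl⟩ := hu
  obtain ⟨q, rfl⟩ := hv
  have hr : r ≠ 0 := by rintro rfl; simp at hu0
  have hq : q ≠ 0 := by rintro rfl; simp at hv0
  have hq' : (q : ℝ) ≠ 0 := by exact_mod_cast hq
  have hpq : 0 < p / q := by
    have : (0 : ℝ) < (p * r) / (q * r) := div_pos hu0 hv0
    rw [mul_div_mul_right _ _ hr] at this
    exact_mod_cast this
  refine ⟨(p / q).den, (p / q).num.toNat, (p / q).den_pos, ?_, ?_⟩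
  · have := Rat.num_pos.2 hpq
    omega
  · have h1 : (((p / q).num.toNat : ℕ) : ℝ) = ((p / q).num : ℝ) := by
      exact_mod_cast congrArg (Int.cast : ℤ → ℝ) (Int.toNat_of_nonneg (Rat.num_pos.2 hpq).le)
    have h2 : (((p / q).den : ℕ) : ℝ) * (p / q) = (p / q).num := by
      exact_mod_cast Rat.den_mul_eq_num (p / q)
    rw [h1, ← h2]
    field_simp

theorem IsBanakh.exists_extension (hX : IsBanakh X) {a p : X} {u w : ℝ}
    (hap : dist a p = u) (hu : u ∈ ratDist X r) (hw : w ∈ ratDist X r) :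
    ∃ q, dist p q = w ∧ dist a q = u + w := by
  rcases (nonneg_of_mem_ratDist hu).eq_or_lt with rfl | hu0
  · obtain ⟨q, -, hq, -⟩ := hX.exists_antipodal p hw.1
    exact ⟨q, hq, by rw [dist_eq_zero.1 hap, hq, zero_add]⟩
  rcases (nonneg_of_mem_ratDist hw).eq_or_lt with rfl | hw0
  · exact ⟨p, dist_self p, by rw [hap, add_zero]⟩
  obtain ⟨k, l, hk, hl, hkl⟩ := exists_mul_eq_mul hu.2 hw.2 hu0 hw0
  exact hX.exists_extension_of_mul_eq hap hw.1 hk hl hkl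

theorem IsBanakh.add_mem_ratDist [Nonempty X] (hX : IsBanakh X) {u v : ℝ} (hu : u ∈ ratDist X r)
    (hv : v ∈ ratDist X r) : u + v ∈ ratDist X r := by
  obtain ⟨a, p, hap⟩ := hu.1
  obtain ⟨q, -, hq⟩ := hX.exists_extension hap hu hv
  exact ⟨⟨a, q, hq⟩, add_mem_ratMultiples hu.2 hv.2⟩

theorem IsBanakh.degenerate (hX : IsBanakh X) {a p q : X} {s t : ℝ}
    (hap : dist a p = s) (haq : dist a q = t) (hs : s ∈ ratMultiples r) (ht : t ∈ ratMultiples r)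
    (hpq : dist p q ∈ ratMultiples r) :
    dist p q = s + t ∨ dist p q = |s - t| := by
  rcases (hap ▸ dist_nonneg : 0 ≤ s).eq_or_lt with rfl | hs0
  · left; rw [← dist_eq_zero.1 hap, haq, zero_add]
  rcases (haq ▸ dist_nonneg : 0 ≤ t).eq_or_lt with rfl | ht0
  · left; rw [← dist_eq_zero.1 haq, dist_comm, hap, add_zero]
  rcases (dist_nonneg : 0 ≤ dist p q).eq_or_lt with h | hw0
  · right; rw [← h, ← hap, ← haq, dist_eq_zero.1 h.symm]; simp
  obtain ⟨k, l, hk, hl, hkl⟩ := exists_mul_eq_mul ht hs ht0 hs0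
  obtain ⟨k', m, hk', hm, hkm⟩ := exists_mul_eq_mul ht hpq ht0 hw0
  refine hX.degenerate_of_mul_eq hap haq rfl (k := k * k') (l := k' * l) (m := k * m)
    (by positivity) (by positivity) (by positivity) ?_ ?_
  · push_cast; linear_combination (k' : ℝ) * hkl
  · push_cast; linear_combination (k : ℝ) * hkm

theorem IsBanakh.exists_between (hX : IsBanakh X) {P Q : X} {u v : ℝ} (hu : u ∈ ratDist X r)
    (hv : v ∈ ratDist X r) (hPQ : dist P Q = u + v) : ∃ x, dist P x = u ∧ dist x Q = v := by
  have : Nonempty X := ⟨P⟩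
  have huv := hX.add_mem_ratDist hu hv
  -- The candidate `x` is the antipode about `P` of a point `y` beyond `P`. Extending from `P` past
  -- `x` gives `Q'`. If `Q' ≠ Q`, extending back from `Q'` leads to `y` again, so `Q` and `Q'` are
  -- equidistant from `y` at radius `2u + v`, yet only `2(u + v)` apart.
  obtain ⟨y, hy, hQy⟩ := hX.exists_extension ((dist_comm Q P).trans hPQ) huv hu
  obtain ⟨x, hx, hyx⟩ := hX.exists_reflection P y
  rw [hy] at hx hyx
  rcases (nonneg_of_mem_ratDist hu).eq_or_lt with rfl | hu0
  · exact ⟨P, dist_self P, by rw [hPQ, zero_add]⟩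
  obtain ⟨Q', hxQ', hPQ'⟩ := hX.exists_extension hx hu hv
  rcases hX.eq_or_dist_eq hPQ hPQ' with rfl | hQQ'
  · exact ⟨x, hx, hxQ'⟩
  exfalso
  obtain ⟨y', hy', hQy'⟩ := hX.exists_extension ((dist_comm Q' P).trans hPQ') huv hu
  have hv0 := nonneg_of_mem_ratDist hv
  rcases hX.eq_or_dist_eq hy' hx with rfl | hx'
  · rw [dist_comm] at hQy'
    linarith
  · have e : y' = y := by
      rcases hX.eq_or_dist_eq hy' hy with h | h
      · exact h
      · exact (hX.eq_reflection (hy'.trans hx.symm) (by rw [dist_comm, hx', hx])).trans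
          (hX.eq_reflection (hy.trans hx.symm) (by rw [dist_comm, hyx, hx])).symm
    subst e
    rw [dist_comm] at hQy hQy'
    rcases hX.eq_or_dist_eq hQy hQy' with rfl | h
    · rw [dist_self] at hQQ'
      linarith
    · linarith

theorem IsBanakh.between_unique (hX : IsBanakh X) {P Q x y : X} {u v : ℝ}
    (hPQ : dist P Q = u + v) (hx : dist P x = u) (hx' : dist x Q = v) (hy : dist P y = u)
    (hy' : dist y Q = v) : x = y := by
  rcases hX.eq_or_dist_eq hx hy with h | h
  · exact h
  rw [dist_comm] at hx' hy'
  rcases hX.eq_or_dist_eq hx' hy' with h' | h'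
  · exact h'
  obtain rfl : u = v := by linarith
  -- Distinct `x`, `y` would fill the sphere of radius `u` about `P`, both at distance `u` from `Q`.
  -- Extending from `Q` past `P` gives a point of that sphere at distance `3u`.
  obtain ⟨z, hz, hQz⟩ := hX.exists_extension_of_mul_eq (k := 1) (l := 2)
    ((dist_comm Q P).trans hPQ) ⟨P, x, hx⟩ one_pos two_pos (by push_cast; ring)
  have hu : u = 0 := by
    rcases hX.eq_or_dist_eq hz hx with rfl | h1
    · linarith
    · have e : z = y := (hX.eq_reflection (hz.trans hx.symm) (by rw [dist_comm, h1, hx])).trans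
        (hX.eq_reflection (hy.trans hx.symm) (by rw [h, hx])).symm
      subst e
      linarith
  rw [← dist_eq_zero, h, hu, mul_zero]

end RatDist

/-! ### The two rays and the chart -/

section Chart

variable {r : ℝ}

theorem ratDist_zero_subset {u : ℝ} (hu : u ∈ ratDist X 0) : u = 0 := by
  obtain ⟨-, q, rfl⟩ := hu
  simp

theorem IsBanakh.exists_rays (hX : IsBanakh X) {a b : X} (hr : r = dist a b) :
    ∃ f g : ℝ → X, f r = b ∧ (∀ u ∈ ratDist X r, dist a (f u) = u) ∧
      (∀ u ∈ ratDist X r, dist a (g u) = u) ∧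
      ∀ u ∈ ratDist X r, ∀ v ∈ ratDist X r, dist (f u) (g v) = u + v := by
  rcases (hr ▸ dist_nonneg : 0 ≤ r).eq_or_lt with rfl | hr0
  · refine ⟨fun _ => b, fun _ => b, rfl, fun u hu => ?_, fun u hu => ?_, fun u hu v hv => ?_⟩
    · rw [ratDist_zero_subset hu, hr]
    · rw [ratDist_zero_subset hu, hr]
    · rw [ratDist_zero_subset hu, ratDist_zero_subset hv]; simp
  have : Nonempty X := ⟨a⟩
  have hrM : r ∈ ratDist X r := ⟨⟨a, b, hr.symm⟩, 1, by simp⟩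
  have hg : ∀ u, ∃ y, u ∈ ratDist X r → dist a y = u ∧ dist b y = r + u := fun u => by
    by_cases hu : u ∈ ratDist X r
    · obtain ⟨y, h⟩ := hX.exists_extension ((dist_comm b a).trans hr.symm) hrM hu
      exact ⟨y, fun _ => h⟩
    · exact ⟨a, fun h => absurd h hu⟩
  choose g hg using hg
  have hf : ∀ u ∈ ratDist X r, dist a (hX.reflection a (g u)) = u := fun u hu => by
    rw [hX.dist_center_reflection, (hg u hu).1]
  refine ⟨fun u => hX.reflection a (g u), g, ?_, hf, fun u hu => (hg u hu).1, ?_⟩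
  · refine (hX.eq_reflection (by rw [← hr, (hg r hrM).1]) ?_).symm
    rw [dist_comm, (hg r hrM).2, (hg r hrM).1, two_mul]
  intro u hu v hv
  beta_reduce
  have hu0 := nonneg_of_mem_ratDist hu
  have hv0 := nonneg_of_mem_ratDist hv
  obtain ⟨hgu, hbu⟩ := hg u hu
  obtain ⟨hgv, hbv⟩ := hg v hv
  -- The extension `y` past `a` is `g u` or its antipode `f u`. In the first case the degenerate
  -- triangle on `b`, `g u`, `g v` leaves only `u = 0` or `v = 0`.
  obtain ⟨y, hy, hvy⟩ := hX.exists_extension ((dist_comm _ a).trans hgv) hv hu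
  rcases hX.eq_or_dist_eq hgu hy with rfl | h
  · have hd : dist (g u) (g v) = u + v := by rw [dist_comm, hvy, add_comm]
    rcases hX.degenerate hbu hbv (add_mem_ratMultiples hrM.2 hu.2)
      (add_mem_ratMultiples hrM.2 hv.2) (hd ▸ add_mem_ratMultiples hu.2 hv.2) with h | h
    · linarith
    · rw [hd, add_sub_add_left_eq_sub] at h
      rcases abs_cases (u - v) with ⟨h', -⟩ | ⟨h', -⟩
      · obtain rfl : v = 0 := by linarith
        rw [← dist_eq_zero.1 hgv, dist_comm, hf u hu, add_zero]
      · obtain rfl : u = 0 := by linarith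
        rw [← dist_eq_zero.1 (hf 0 hu), hgv, zero_add]
  · rw [← hX.eq_reflection (y := y) (by rw [hy, hgu]) (by rw [h, hgu]), dist_comm, hvy, add_comm]

/-- Two maps of `M_r` onto the two rays of the sphere `S(a;ℚr)`. -/
structure IsRays (a : X) (r : ℝ) (f g : ℝ → X) : Prop where
  dist_left : ∀ u ∈ ratDist X r, dist a (f u) = u
  dist_right : ∀ u ∈ ratDist X r, dist a (g u) = u
  dist_left_right : ∀ u ∈ ratDist X r, ∀ v ∈ ratDist X r, dist (f u) (g v) = u + v

variable {a : X} {f g : ℝ → X}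

theorem IsRays.symm (h : IsRays a r f g) : IsRays a r g f :=
  ⟨h.dist_right, h.dist_left, fun u hu v hv => by
    rw [dist_comm, h.dist_left_right v hv u hu, add_comm]⟩

theorem IsRays.eq_or_eq (h : IsRays a r f g) (hX : IsBanakh X) {u : ℝ} (hu : u ∈ ratDist X r)
    {x : X} (hx : dist a x = u) : x = f u ∨ x = g u := by
  rcases hX.eq_or_dist_eq (h.dist_left u hu) hx with h1 | h1
  · exact Or.inl h1.symm
  · right
    refine (hX.eq_reflection (hx.trans (h.dist_left u hu).symm)
      (by rw [h1, h.dist_left u hu])).trans (hX.eq_reflection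
      ((h.dist_right u hu).trans (h.dist_left u hu).symm) ?_).symm
    rw [h.dist_left_right u hu u hu, h.dist_left u hu, two_mul]

theorem IsRays.dist_left_add (h : IsRays a r f g) (hX : IsBanakh X) {u w : ℝ}
    (hu : u ∈ ratDist X r) (hw : w ∈ ratDist X r) : dist (f u) (f (u + w)) = w := by
  have : Nonempty X := ⟨a⟩
  have huw := hX.add_mem_ratDist hu hw
  obtain ⟨x, hx, hxw⟩ := hX.exists_between hu hw (h.dist_left _ huw)
  rcases h.eq_or_eq hX hu hx with rfl | rfl
  · exact hxw
  · rw [dist_comm, h.dist_left_right _ huw u hu] at hxw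
    have := nonneg_of_mem_ratDist hu
    obtain rfl : u = 0 := by linarith
    rw [← dist_eq_zero.1 (h.dist_left 0 hu), h.dist_left _ huw, zero_add]

/-- The point at signed distance `u - v` is characterised by its distances to the rays. -/
theorem IsRays.exists_point (h : IsRays a r f g) (hX : IsBanakh X) (s : ℝ) :
    ∃ x, ∀ u ∈ ratDist X r, ∀ v ∈ ratDist X r, s = u - v → dist (f u) x = v ∧ dist x (g v) = u := by
  have : Nonempty X := ⟨a⟩
  by_cases hs : ∃ u ∈ ratDist X r, ∃ v ∈ ratDist X r, s = u - v
  swap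
  · exact ⟨a, fun u hu v hv hsuv => absurd ⟨u, hu, v, hv, hsuv⟩ hs⟩
  have between : ∀ u ∈ ratDist X r, ∀ v ∈ ratDist X r, ∃ x, dist (f u) x = v ∧ dist x (g v) = u :=
    fun u hu v hv => hX.exists_between hv hu (by rw [h.dist_left_right u hu v hv, add_comm])
  -- A point serving `(u, v)` also serves `(u + w, v + w)`. Two representations of `s` thus meet in
  -- a common one, where betweenness is unique.
  have grow : ∀ u ∈ ratDist X r, ∀ v ∈ ratDist X r, ∀ w ∈ ratDist X r, ∀ x, dist (f u) x = v →
      dist x (g v) = u → dist (f (u + w)) x = v + w ∧ dist x (g (v + w)) = u + w := by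
    intro u hu v hv w hw x h1 h2
    have e1 := h.dist_left_add hX hu hw
    have e2 := h.symm.dist_left_add hX hv hw
    have e3 := h.dist_left_right _ (hX.add_mem_ratDist hu hw) _ (hX.add_mem_ratDist hv hw)
    have t1 := dist_triangle_left (f (u + w)) x (f u)
    have t2 := dist_triangle x (g v) (g (v + w))
    have t3 := dist_triangle (f (u + w)) x (g (v + w))
    constructor <;> linarith
  obtain ⟨u₀, hu₀, v₀, hv₀, rfl⟩ := hs
  obtain ⟨x, hx1, hx2⟩ := between u₀ hu₀ v₀ hv₀
  refine ⟨x, fun u hu v hv huv => ?_⟩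
  obtain ⟨y, hy1, hy2⟩ := between u hu v hv
  obtain ⟨hx3, hx4⟩ := grow u₀ hu₀ v₀ hv₀ v hv x hx1 hx2
  obtain ⟨hy3, hy4⟩ := grow u hu v hv v₀ hv₀ y hy1 hy2
  rw [show u + v₀ = u₀ + v by linarith, add_comm v v₀] at hy3 hy4
  have hxy : x = y := hX.between_unique (by
    rw [h.dist_left_right _ (hX.add_mem_ratDist hu₀ hv) _ (hX.add_mem_ratDist hv₀ hv), add_comm])
    hx3 hx4 hy3 hy4
  rw [hxy]
  exact ⟨hy1, hy2⟩

/-- A map on `M_r - M_r` sending `u - v` to the point at distance `v` from the point `u` of the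
positive ray and at distance `u` from the point `v` of the negative ray. -/
structure IsChart (a : X) (r : ℝ) (f g L : ℝ → X) : Prop extends IsRays a r f g where
  dist_left_point : ∀ u ∈ ratDist X r, ∀ v ∈ ratDist X r, dist (f u) (L (u - v)) = v
  dist_point_right : ∀ u ∈ ratDist X r, ∀ v ∈ ratDist X r, dist (L (u - v)) (g v) = u

theorem IsRays.exists_chart (h : IsRays a r f g) (hX : IsBanakh X) : ∃ L, IsChart a r f g L := by
  choose L hL using h.exists_point hX
  exact ⟨L, h, fun u hu v hv => (hL _ u hu v hv rfl).1, fun u hu v hv => (hL _ u hu v hv rfl).2⟩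

variable {L : ℝ → X}

theorem IsChart.eq_left (h : IsChart a r f g L) {u : ℝ} (hu : u ∈ ratDist X r) : L u = f u := by
  have := h.dist_left_point u hu 0 (zero_mem_ratDist a r)
  rw [sub_zero] at this
  exact (dist_eq_zero.1 this).symm

theorem IsChart.eq_right (h : IsChart a r f g L) {v : ℝ} (hv : v ∈ ratDist X r) :
    L (-v) = g v := by
  have := h.dist_point_right 0 (zero_mem_ratDist a r) v hv
  rw [zero_sub] at this
  exact dist_eq_zero.1 this

/-! ### Metric estimates for the chart -/

theorem ratDiff_subset_ratMultiples : ratDiff X r ⊆ ratMultiples r := by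
  rintro _ ⟨u, hu, v, hv, rfl⟩
  exact sub_mem_ratMultiples hu.2 hv.2

theorem IsBanakh.exists_common_sub [Nonempty X] (hX : IsBanakh X) {s t : ℝ} (hs : s ∈ ratDiff X r)
    (ht : t ∈ ratDiff X r) : ∃ p ∈ ratDist X r, ∃ q ∈ ratDist X r, ∃ w ∈ ratDist X r,
      s = p - w ∧ t = q - w := by
  obtain ⟨u, hu, v, hv, rfl⟩ := hs
  obtain ⟨u', hu', v', hv', rfl⟩ := ht
  exact ⟨u + v', hX.add_mem_ratDist hu hv', u' + v, hX.add_mem_ratDist hu' hv,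
    v + v', hX.add_mem_ratDist hv hv', by ring, by ring⟩

theorem IsChart.abs_sub_le_dist (h : IsChart a r f g L) (hX : IsBanakh X) {s t : ℝ}
    (hs : s ∈ ratDiff X r) (ht : t ∈ ratDiff X r) : |s - t| ≤ dist (L s) (L t) := by
  have : Nonempty X := ⟨a⟩
  obtain ⟨p, hp, q, hq, w, hw, rfl, rfl⟩ := hX.exists_common_sub hs ht
  have := abs_dist_sub_le (L (p - w)) (L (q - w)) (g w)
  rwa [h.dist_point_right p hp w hw, h.dist_point_right q hq w hw,
    ← sub_sub_sub_cancel_right p q w] at this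

theorem IsChart.dist_eq_of_mem (h : IsChart a r f g L) (hX : IsBanakh X) {s t : ℝ}
    (hs : s ∈ ratDiff X r) (ht : t ∈ ratDiff X r) (hst : |s - t| ∈ ratDist X r) :
    dist (L s) (L t) = |s - t| := by
  have : Nonempty X := ⟨a⟩
  wlog hle : s ≤ t generalizing s t
  · rw [dist_comm, abs_sub_comm]
    exact this ht hs (by rwa [abs_sub_comm]) (le_of_not_ge hle)
  rw [abs_sub_comm, abs_of_nonneg (sub_nonneg.2 hle)] at hst ⊢
  obtain ⟨p, hp, q, hq, w, hw, rfl, rfl⟩ := hX.exists_common_sub hs ht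
  rw [sub_sub_sub_cancel_right] at hst ⊢
  obtain ⟨x, hx, hxt⟩ := hX.exists_between hp hst (P := g w) (Q := L (q - w))
    (by rw [dist_comm, h.dist_point_right q hq w hw]; ring)
  have hpq := hX.add_mem_ratDist hp hq
  have hqw := hX.add_mem_ratDist hq hw
  have hpw := hX.add_mem_ratDist hp hw
  have e1 := h.dist_left_point _ hpq _ hpw
  have e2 := h.dist_left_point _ hpq _ hqw
  have e3 := h.dist_left_right _ hpq w hw
  rw [show p + q - (p + w) = q - w by ring, dist_comm] at e1
  rw [show p + q - (q + w) = p - w by ring, dist_comm] at e2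
  rw [dist_comm] at e3
  -- The point `x` and `L (p - w)` both split the segment from `g w` to `f (p + q)` as `p + (q +
  -- w)`.
  have hxP : dist x (f (p + q)) = q + w := by
    have t1 := dist_triangle x (L (q - w)) (f (p + q))
    have t2 := dist_triangle (g w) x (f (p + q))
    linarith
  have hxs : x = L (p - w) := hX.between_unique (u := p) (v := q + w) (by rw [e3]; ring) hx hxP
    (by rw [dist_comm, h.dist_point_right p hp w hw]) e2
  rw [← hxs, hxt]

theorem IsChart.dist_eq_of_dist_mem (h : IsChart a r f g L) (hX : IsBanakh X)
    (hr : r ∈ ratDist X r) {s t : ℝ}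
    (hs : s ∈ ratDiff X r) (ht : t ∈ ratDiff X r) (hd : dist (L s) (L t) ∈ ratMultiples r) :
    dist (L s) (L t) = |s - t| := by
  have : Nonempty X := ⟨a⟩
  obtain ⟨p, hp, q, hq, w, hw, rfl, rfl⟩ := hX.exists_common_sub hs ht
  have below : ∀ p ∈ ratDist X r, ∀ q ∈ ratDist X r, ∀ w ∈ ratDist X r,
      dist (L (p - w)) (L (q - w)) ∈ ratMultiples r →
      dist (L (p - w)) (L (q - w)) = p + q ∨ dist (L (p - w)) (L (q - w)) = |p - q| :=
    fun p hp q hq w hw hd => hX.degenerate (by rw [dist_comm, h.dist_point_right p hp w hw])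
      (by rw [dist_comm, h.dist_point_right q hq w hw]) hp.2 hq.2 hd
  rw [sub_sub_sub_cancel_right]
  rcases below p hp q hq w hw hd with h1 | h1
  swap
  · exact h1
  -- Viewed from `g (w + r)` instead of `g w`, the unwanted alternative `p + q` becomes `p + q +
  -- 2r`. Both can hold only if `r = 0`.
  have h2 := below (p + r) (hX.add_mem_ratDist hp hr) (q + r) (hX.add_mem_ratDist hq hr) (w + r)
    (hX.add_mem_ratDist hw hr)
  simp only [add_sub_add_right_eq_sub] at h2
  rcases h2 hd with h2 | h2
  swap
  · exact h2
  obtain rfl : r = 0 := by linarith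
  rw [h1, ratDist_zero_subset hp, ratDist_zero_subset hq]
  simp

theorem IsChart.dist_mem_iff (h : IsChart a r f g L) (hX : IsBanakh X) (hr : r ∈ ratDist X r)
    {s t : ℝ} (hs : s ∈ ratDiff X r) (ht : t ∈ ratDiff X r) :
    (dist (L s) (L t) = |s - t| ↔ |s - t| ∈ ratDist X r) ∧
      (|s - t| ∈ ratDist X r ↔ dist (L s) (L t) ∈ ratMultiples r) := by
  have key : dist (L s) (L t) = |s - t| → |s - t| ∈ ratDist X r := fun e =>
    ⟨⟨_, _, e⟩, abs_mem_ratMultiples (sub_mem_ratMultiples (ratDiff_subset_ratMultiples hs)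
      (ratDiff_subset_ratMultiples ht))⟩
  refine ⟨⟨key, h.dist_eq_of_mem hX hs ht⟩, fun hm => ?_, fun hd =>
    key (h.dist_eq_of_dist_mem hX hr hs ht hd)⟩
  rw [h.dist_eq_of_mem hX hs ht hm]
  exact hm.2

theorem IsBanakh.exists_addSubgroup [Nonempty X] (hX : IsBanakh X) :
    ∃ H : AddSubgroup ℝ, (H : Set ℝ) = ratDiff X r := by
  refine ⟨{ carrier := ratDiff X r, add_mem' := ?_, zero_mem' := ?_, neg_mem' := ?_ }, rfl⟩
  · rintro _ _ ⟨u, hu, v, hv, rfl⟩ ⟨u', hu', v', hv', rfl⟩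
    exact ⟨u + u', hX.add_mem_ratDist hu hu', v + v', hX.add_mem_ratDist hv hv', by ring⟩
  · exact zero_mem_ratDiff (Classical.arbitrary X) r
  · rintro _ ⟨u, hu, v, hv, rfl⟩
    exact ⟨v, hv, u, hu, by ring⟩

theorem mem_ratDiff_of_mem_ratDist [Nonempty X] {u : ℝ} (hu : u ∈ ratDist X r) :
    u ∈ ratDiff X r :=
  ⟨u, hu, 0, zero_mem_ratDist (Classical.arbitrary X) r, sub_zero u⟩

theorem IsBanakh.add_mem_ratDiff [Nonempty X] (hX : IsBanakh X) {s t : ℝ} (hs : s ∈ ratDiff X r)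
    (ht : t ∈ ratDiff X r) : s + t ∈ ratDiff X r := by
  obtain ⟨H, hH⟩ := hX.exists_addSubgroup (r := r)
  rw [← hH] at hs ht ⊢
  exact H.add_mem hs ht

theorem IsBanakh.sub_mem_ratDiff [Nonempty X] (hX : IsBanakh X) {s t : ℝ} (hs : s ∈ ratDiff X r)
    (ht : t ∈ ratDiff X r) : s - t ∈ ratDiff X r := by
  obtain ⟨H, hH⟩ := hX.exists_addSubgroup (r := r)
  rw [← hH] at hs ht ⊢
  exact H.sub_mem hs ht

theorem IsChart.dist_le_add (h : IsChart a r f g L) (hX : IsBanakh X) {s t u v : ℝ}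
    (hs : s ∈ ratDiff X r) (ht : t ∈ ratDiff X r) (hu : u ∈ ratDist X r) (hv : v ∈ ratDist X r)
    (huv : |t - s| = u - v) : dist (L s) (L t) ≤ u + v := by
  have : Nonempty X := ⟨a⟩
  wlog hle : s ≤ t generalizing s t
  · rw [dist_comm]
    exact this ht hs (by rwa [abs_sub_comm]) (le_of_not_ge hle)
  rw [abs_of_nonneg (sub_nonneg.2 hle)] at huv
  -- Overshoot to `s + u`, then return by `v` to `t`.
  have hsu : s + u ∈ ratDiff X r := hX.add_mem_ratDiff hs (mem_ratDiff_of_mem_ratDist hu)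
  have e1 : |s - (s + u)| = u := by
    rw [sub_add_cancel_left, abs_neg, abs_of_nonneg (nonneg_of_mem_ratDist hu)]
  have e2 : |s + u - t| = v := by
    rw [show s + u - t = v by linarith, abs_of_nonneg (nonneg_of_mem_ratDist hv)]
  have d1 := h.dist_eq_of_mem hX hs hsu (e1.symm ▸ hu)
  have d2 := h.dist_eq_of_mem hX hsu ht (e2.symm ▸ hv)
  have := dist_triangle (L s) (L (s + u)) (L t)
  linarith

theorem IsChart.dist_le_sInf (h : IsChart a r f g L) (hX : IsBanakh X) {s t : ℝ}
    (hs : s ∈ ratDiff X r) (ht : t ∈ ratDiff X r) :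
    dist (L s) (L t) ≤ sInf {w : ℝ | ∃ u ∈ ratDist X r, ∃ v ∈ ratDist X r,
      |t - s| = u - v ∧ w = u + v} := by
  have : Nonempty X := ⟨a⟩
  refine le_csInf ?_ ?_
  · have : |t - s| ∈ ratDiff X r := by
      rcases abs_choice (t - s) with e | e <;> rw [e]
      · exact hX.sub_mem_ratDiff ht hs
      · rw [neg_sub]
        exact hX.sub_mem_ratDiff hs ht
    obtain ⟨u, hu, v, hv, huv⟩ := this
    exact ⟨u + v, u, hu, v, hv, huv.symm, rfl⟩
  · rintro _ ⟨u, hu, v, hv, huv, rfl⟩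
    exact h.dist_le_add hX hs ht hu hv huv

/-! ### Image of the chart and uniqueness -/

theorem IsChart.mem_hypersphere (h : IsChart a r f g L) {s : ℝ} (hs : s ∈ ratDiff X r) :
    L s ∈ hypersphere a r := by
  obtain ⟨u, hu, v, hv, rfl⟩ := hs
  refine Set.mem_biUnion (x := f u) ?_ ?_
  · rw [dSphere, Set.mem_ofPred_eq, h.dist_left u hu]
    exact hu.2
  · rw [dSphere, Set.mem_ofPred_eq, h.dist_left_point u hu v hv]
    exact hv.2

theorem IsChart.exists_of_mem_dSphere (h : IsChart a r f g L) (hX : IsBanakh X) {x : X}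
    (hx : x ∈ dSphere a (ratMultiples r)) : ∃ t ∈ ratDist X r ∪ -ratDist X r, L t = x := by
  have hM : dist a x ∈ ratDist X r := ⟨⟨a, x, rfl⟩, hx⟩
  rcases h.eq_or_eq hX hM rfl with e | e
  · exact ⟨_, Or.inl hM, by rw [h.eq_left hM, ← e]⟩
  · exact ⟨-dist a x, Or.inr (by rwa [Set.mem_neg, neg_neg]), by rw [h.eq_right hM, ← e]⟩

theorem IsChart.mem_dSphere (h : IsChart a r f g L) {t : ℝ}
    (ht : t ∈ ratDist X r ∪ -ratDist X r) : L t ∈ dSphere a (ratMultiples r) := by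
  rw [dSphere, Set.mem_ofPred_eq]
  rcases ht with ht | ht
  · rw [h.eq_left ht, h.dist_left t ht]
    exact ht.2
  · have := h.eq_right (Set.mem_neg.1 ht)
    rw [neg_neg] at this
    rw [this, h.dist_right _ ht]
    exact ht.2

theorem mem_ratDiff_of_mem_union [Nonempty X] {t : ℝ} (ht : t ∈ ratDist X r ∪ -ratDist X r) :
    t ∈ ratDiff X r := by
  rcases ht with ht | ht
  · exact mem_ratDiff_of_mem_ratDist ht
  · exact ⟨0, zero_mem_ratDist (Classical.arbitrary X) r, -t, ht, by ring⟩

theorem IsChart.exists_of_mem_hypersphere (h : IsChart a r f g L) (hX : IsBanakh X) {x : X}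
    (hx : x ∈ hypersphere a r) : ∃ t ∈ ratDiff X r, L t = x := by
  have : Nonempty X := ⟨a⟩
  rw [hypersphere, Set.mem_iUnion₂] at hx
  obtain ⟨y, hy, hyx⟩ := hx
  obtain ⟨s, hs, rfl⟩ := h.exists_of_mem_dSphere hX hy
  replace hs := mem_ratDiff_of_mem_union hs
  obtain ⟨v, hv⟩ : ∃ v, dist (L s) x = v := ⟨_, rfl⟩
  have hM : v ∈ ratDist X r := ⟨⟨_, _, hv⟩, hv ▸ hyx⟩
  have hvD := mem_ratDiff_of_mem_ratDist hM
  have hv0 := nonneg_of_mem_ratDist hM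
  have h1 : s + v ∈ ratDiff X r := hX.add_mem_ratDiff hs hvD
  have h2 : s - v ∈ ratDiff X r := hX.sub_mem_ratDiff hs hvD
  have e1 : dist (L s) (L (s + v)) = v := by
    have : |s - (s + v)| = v := by rw [sub_add_cancel_left, abs_neg, abs_of_nonneg hv0]
    rw [h.dist_eq_of_mem hX hs h1 (this.symm ▸ hM), this]
  have e2 : dist (L s) (L (s - v)) = v := by
    have : |s - (s - v)| = v := by rw [sub_sub_cancel, abs_of_nonneg hv0]
    rw [h.dist_eq_of_mem hX hs h2 (this.symm ▸ hM), this]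
  -- The lower bound makes `L (s + v)` and `L (s - v)` antipodal, so they exhaust the sphere
  -- containing `x`.
  have e3 := h.abs_sub_le_dist hX h1 h2
  rw [show s + v - (s - v) = 2 * v by ring, abs_of_nonneg (by linarith)] at e3
  rcases hX.eq_or_dist_eq e1 hv with e | e
  · exact ⟨_, h1, e⟩
  refine ⟨_, h2, (hX.eq_reflection (c := L s) (x := L (s + v)) (by rw [e1, e2]) ?_).trans
    (hX.eq_reflection (by rw [e1, hv]) (by rw [e, e1])).symm⟩
  refine le_antisymm ?_ (by rwa [e1])
  have := dist_triangle_left (L (s + v)) (L (s - v)) (L s)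
  rw [e1] at *
  linarith

/-- A map on `M_r - M_r` with the listed metric properties agrees with the chart. -/
theorem IsChart.eq_of_dist (h : IsChart a r f g L) (hX : IsBanakh X) (hr : r ∈ ratDist X r)
    {l : ℝ → X} (h0 : l 0 = a) (h1 : l r = f r)
    (hmem : ∀ t ∈ ratDist X r ∪ -ratDist X r, l t ∈ dSphere a (ratMultiples r))
    (hd : ∀ s ∈ ratDiff X r, ∀ t ∈ ratDiff X r,
      (dist (l s) (l t) = |s - t| ↔ |s - t| ∈ ratDist X r) ∧
        (|s - t| ∈ ratDist X r ↔ dist (l s) (l t) ∈ ratMultiples r))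
    {s : ℝ} (hs : s ∈ ratDiff X r) : l s = L s := by
  have : Nonempty X := ⟨a⟩
  have hr0 := nonneg_of_mem_ratDist hr
  have hrD := mem_ratDiff_of_mem_ratDist hr
  have h0D := zero_mem_ratDiff a r
  have hdist : ∀ t ∈ ratDist X r ∪ -ratDist X r, dist a (l t) = |t| := by
    intro t ht
    have := hd 0 h0D t (mem_ratDiff_of_mem_union ht)
    rw [h0, zero_sub, abs_neg] at this
    exact this.1.2 (this.2.2 (hmem t ht))
  have pos : ∀ u ∈ ratDist X r, l u = f u := by
    intro u hu
    have hu0 := nonneg_of_mem_ratDist hu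
    have hau := hdist u (Or.inl hu)
    rw [abs_of_nonneg hu0] at hau
    rcases h.eq_or_eq hX hu hau with e | e
    · exact e
    have e1 : dist (l u) (l r) = r + u := by
      rw [e, h1, dist_comm, h.dist_left_right r hr u hu]
    have e2 := hd u (mem_ratDiff_of_mem_ratDist hu) r hrD
    have e3 := e2.1.2 (e2.2.2 (e1 ▸ add_mem_ratMultiples hr.2 hu.2))
    rw [e1] at e3
    rcases abs_cases (u - r) with ⟨h', -⟩ | ⟨h', -⟩
    · obtain rfl : r = 0 := by linarith
      rw [ratDist_zero_subset hu, h1]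
    · obtain rfl : u = 0 := by linarith
      rw [h0, dist_eq_zero.1 (h.dist_left 0 hu)]
  have neg : ∀ u ∈ ratDist X r, l (-u) = g u := by
    intro u hu
    have hu0 := nonneg_of_mem_ratDist hu
    have hmu : -u ∈ ratDist X r ∪ -ratDist X r := Or.inr (by rwa [Set.mem_neg, neg_neg])
    have hau := hdist (-u) hmu
    rw [abs_neg, abs_of_nonneg hu0] at hau
    rcases h.eq_or_eq hX hu hau with e | e
    swap
    · exact e
    have e1 : |(-u) - u| = u + u := by
      rw [abs_of_nonpos (by linarith)]
      ring
    have e2 := (hd (-u) (mem_ratDiff_of_mem_union hmu) u (mem_ratDiff_of_mem_ratDist hu)).1.2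
      (e1 ▸ hX.add_mem_ratDist hu hu)
    rw [e, pos u hu, dist_self, e1] at e2
    obtain rfl : u = 0 := by linarith
    rw [neg_zero, h0, dist_eq_zero.1 (h.dist_right 0 hu)]
  obtain ⟨u, hu, v, hv, rfl⟩ := hs
  have hs : u - v ∈ ratDiff X r := ⟨u, hu, v, hv, rfl⟩
  have hnv : -v ∈ ratDiff X r :=
    mem_ratDiff_of_mem_union (Or.inr (by rwa [Set.mem_neg, neg_neg]))
  have a1 : |u - (u - v)| = v := by
    rw [sub_sub_cancel, abs_of_nonneg (nonneg_of_mem_ratDist hv)]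
  have a2 : |u - v - -v| = u := by
    rw [sub_neg_eq_add, sub_add_cancel, abs_of_nonneg (nonneg_of_mem_ratDist hu)]
  have e1 := (hd u (mem_ratDiff_of_mem_ratDist hu) (u - v) hs).1.2 (a1.symm ▸ hv)
  have e2 := (hd (u - v) hs (-v) hnv).1.2 (a2.symm ▸ hu)
  rw [a1, pos u hu] at e1
  rw [a2, neg v hv] at e2
  exact hX.between_unique (by rw [h.dist_left_right u hu v hv, add_comm]) e1 e2
    (h.dist_left_point u hu v hv) (h.dist_point_right u hu v hv)

end Chart

end Banakh

theorem theoremt {X : Type*} [MetricSpace X] (hX : Banakh.IsBanakh X) (a b : X) (r : ℝ)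
    (hr : r = dist a b) :
    (∃ H : AddSubgroup ℝ, (H : Set ℝ) = Banakh.ratDiff X r ∧
      (H : Set ℝ) ⊆ Banakh.ratMultiples r) ∧
    ∃! ℓ : ↥(Banakh.ratDiff X r) → ↥(Banakh.hypersphere a r),
      Function.Bijective ℓ ∧
      (ℓ ⟨0, Banakh.zero_mem_ratDiff a r⟩ : X) = a ∧
      (ℓ ⟨r, Banakh.mem_ratDiff_of_eq_dist hr⟩ : X) = b ∧
      {x : X | ∃ t : ↥(Banakh.ratDiff X r),
          (t : ℝ) ∈ Banakh.ratDist X r ∪ -Banakh.ratDist X r ∧ (ℓ t : X) = x} =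
        Banakh.dSphere a (Banakh.ratMultiples r) ∧
      ∀ s t : ↥(Banakh.ratDiff X r),
        |(s : ℝ) - (t : ℝ)| ≤ dist (ℓ s : X) (ℓ t : X) ∧
        dist (ℓ s : X) (ℓ t : X) ≤
          sInf {w : ℝ | ∃ u ∈ Banakh.ratDist X r, ∃ v ∈ Banakh.ratDist X r,
            |(t : ℝ) - (s : ℝ)| = u - v ∧ w = u + v} ∧
        (dist (ℓ s : X) (ℓ t : X) = |(s : ℝ) - (t : ℝ)| ↔
          |(s : ℝ) - (t : ℝ)| ∈ Banakh.ratDist X r) ∧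
        (|(s : ℝ) - (t : ℝ)| ∈ Banakh.ratDist X r ↔
          dist (ℓ s : X) (ℓ t : X) ∈ Banakh.ratMultiples r) := by
  have : Nonempty X := ⟨a⟩
  have hrM : r ∈ Banakh.ratDist X r := ⟨⟨a, b, hr.symm⟩, 1, by simp⟩
  refine ⟨?_, ?_⟩
  · obtain ⟨H, hH⟩ := hX.exists_addSubgroup (r := r)
    exact ⟨H, hH, hH ▸ Banakh.ratDiff_subset_ratMultiples⟩
  obtain ⟨f, g, hfr, hf, hg, hfg⟩ := hX.exists_rays hr
  obtain ⟨L, h⟩ := Banakh.IsRays.exists_chart ⟨hf, hg, hfg⟩ hX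
  have hL0 : L 0 = a := by
    rw [h.eq_left (Banakh.zero_mem_ratDist a r),
      dist_eq_zero.1 (hf 0 (Banakh.zero_mem_ratDist a r))]
  refine ⟨fun t => ⟨L t, h.mem_hypersphere t.2⟩, ⟨⟨?_, ?_⟩, hL0, ?_, ?_, ?_⟩, ?_⟩
  · intro s t hst
    have := h.abs_sub_le_dist hX s.2 t.2
    rw [Subtype.mk_eq_mk.1 hst, dist_self] at this
    exact Subtype.ext (sub_eq_zero.1 (abs_nonpos_iff.1 this))
  · rintro ⟨x, hx⟩
    obtain ⟨t, ht, rfl⟩ := h.exists_of_mem_hypersphere hX hx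
    exact ⟨⟨t, ht⟩, rfl⟩
  · exact (h.eq_left hrM).trans hfr
  · ext x
    constructor
    · rintro ⟨t, ht, rfl⟩
      exact h.mem_dSphere ht
    · intro hx
      obtain ⟨t, ht, rfl⟩ := h.exists_of_mem_dSphere hX hx
      exact ⟨⟨t, Banakh.mem_ratDiff_of_mem_union ht⟩, ht, rfl⟩
  · exact fun s t => ⟨h.abs_sub_le_dist hX s.2 t.2, h.dist_le_sInf hX s.2 t.2,
      h.dist_mem_iff hX hrM s.2 t.2⟩
  · rintro l ⟨-, hl0, hlr, hl, hd⟩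
    classical
    -- The default value `a` is immaterial, since the comparison only concerns points of `M_r -
    -- M_r`.
    let l' : ℝ → X := fun t => if ht : t ∈ Banakh.ratDiff X r then l ⟨t, ht⟩ else a
    have hl' : ∀ t (ht : t ∈ Banakh.ratDiff X r), l' t = l ⟨t, ht⟩ := fun t ht => dif_pos ht
    funext t
    refine Subtype.ext ((hl' t t.2).symm.trans (h.eq_of_dist hX hrM ?_ ?_ ?_ ?_ t.2))
    · rw [hl' 0 (Banakh.zero_mem_ratDiff a r), hl0]
    · rw [hl' r (Banakh.mem_ratDiff_of_eq_dist hr), hlr, hfr]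
    · intro t ht
      have htD := Banakh.mem_ratDiff_of_mem_union ht
      rw [hl' t htD, ← hl]
      exact ⟨⟨t, htD⟩, ht, rfl⟩
    · intro s hs t ht
      rw [hl' s hs, hl' t ht]
      exact (hd ⟨s, hs⟩ ⟨t, ht⟩).2.2
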